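/- Let $K$ be a field, let $A$ be a finite-dimensional (associative, unital) $K$-algebra, and let $D(A)=\operatorname{Hom}_K(A,K)$ be regarded as an $A$-bimodule by $(afb)(x)=f(bxa)$. Call a finite-dimensional $K$-algebra $B$ symmetric if $B\cong D(B)$ as $B$-bimodules, and call $A$ gendo-symmetric if $A\cong\operatorname{End}_B(M)$ as $K$-algebras for some finite-dimensional symmetric $K$-algebra $B$ and some finite-dimensional right $B$-module $M$ that is a generator, i.e. such that the right module $B_B$ is a direct summand of $M^n$ for some $n\ge 0$. For an $A$-bimodule $W$ (on which $K$ acts centrally), a bocs structure on $(A,W)$ (equivalently, an $A$-coring structure on $W$) consists of $A$-bimodule homomorphisms $\mu:W\to W\otimes_A W$ (comultiplication) and $\varepsilon:W\to A$ (counit) such that, for all $w \in W$, $$(1_W\otimes_A\varepsilon)(\mu(w))=w\otimes 1,\qquad (\varepsilon\otimes_A 1_W)(\mu(w))=1\otimes w,$$ and $(\mu\otimes_A 1_W)\mu=(1_W\otimes_A\mu)\mu$, where $(W\otimes_A W)\otimes_A W$ and $W\otimes_A(W\otimes_A W)$ are identified in the canonical way. Then: 1. $A$ is gendo-symmetric if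 and only if there is a bocs structure on $(A,D(A))$. 2. For every bocs structure $(\mu,\varepsilon)$ on $(A,D(A))$, the comultiplication $\mu:D(A)\to D(A)\otimes_A D(A)$ is an isomorphism of $A$-bimodules. -/

import Mathlib

open scoped TensorProduct
open MulOpposite (op)

namespace BocsTheory

universe u v w₁ w₂ w₃ w₄

/-! Conventions. `A` is a `K`-algebra. An `A`-bimodule `V` (with central `K`-action) is given by a
left action of `A`, a right action of `A` (encoded, as in Mathlib, by `Module Aᵐᵒᵖ V`, so that
`v · a` is written `op a • v`), which commute and both induce the given `K`-module structure. -/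

section BimoduleHom

variable (K : Type v) [Field K] (A : Type u) [Ring A] [Algebra K A]
  (V : Type w₁) [AddCommGroup V] [Module K V] [Module A V] [Module Aᵐᵒᵖ V]
  (W : Type w₂) [AddCommGroup W] [Module K W] [Module A W] [Module Aᵐᵒᵖ W]

/-- Homomorphisms of `A`-bimodules. -/
structure BimoduleHom extends V →ₗ[K] W where
  map_left : ∀ (a : A) (v : V), toFun (a • v) = a • toFun v
  map_right : ∀ (a : A) (v : V), toFun (op a • v) = op a • toFun v

end BimoduleHom

section Tensor

variable (K : Type v) [Field K] (A : Type u) [Ring A]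
  (V : Type w₁) [AddCommGroup V] [Module K V] [Module Aᵐᵒᵖ V]
  (W : Type w₂) [AddCommGroup W] [Module K W] [Module A W]

/-- The relations `(v · a) ⊗ w = v ⊗ (a · w)` of the tensor product over `A`. -/
def balanceRel : Submodule K (V ⊗[K] W) :=
  Submodule.span K
    {x | ∃ (v : V) (a : A) (w : W), x = (op a • v) ⊗ₜ[K] w - v ⊗ₜ[K] (a • w)}

/-- The tensor product `V ⊗_A W` over the (noncommutative) algebra `A`, as the quotient of
`V ⊗_K W` by the balancing relations. -/
def BTensor : Type max w₁ w₂ := (V ⊗[K] W) ⧸ balanceRel K A V W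

noncomputable instance : AddCommGroup (BTensor K A V W) :=
  inferInstanceAs (AddCommGroup ((V ⊗[K] W) ⧸ balanceRel K A V W))

noncomputable instance : Module K (BTensor K A V W) :=
  inferInstanceAs (Module K ((V ⊗[K] W) ⧸ balanceRel K A V W))

namespace BTensor

/-- The canonical map `V ⊗_K W → V ⊗_A W`. -/
noncomputable def proj : V ⊗[K] W →ₗ[K] BTensor K A V W := (balanceRel K A V W).mkQ

variable {V W}

/-- The element `v ⊗ w` of `V ⊗_A W`. -/
noncomputable def tmul (v : V) (w : W) : BTensor K A V W := proj K A V W (v ⊗ₜ[K] w)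

theorem tmul_balance (v : V) (a : A) (w : W) :
    tmul K A (op a • v) w = tmul K A v (a • w) := by
  have h : (op a • v) ⊗ₜ[K] w - v ⊗ₜ[K] (a • w) ∈ balanceRel K A V W :=
    Submodule.subset_span ⟨v, a, w, rfl⟩
  exact (Submodule.Quotient.eq _).2 h

theorem tmul_add (v : V) (w w' : W) :
    tmul K A v (w + w') = tmul K A v w + tmul K A v w' := by
  simp [tmul, TensorProduct.tmul_add]

theorem add_tmul (v v' : V) (w : W) :
    tmul K A (v + v') w = tmul K A v w + tmul K A v' w := by
  simp [tmul, TensorProduct.add_tmul]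

theorem tmul_smul (k : K) (v : V) (w : W) :
    tmul K A v (k • w) = k • tmul K A v w := by
  simp [tmul]

theorem smul_tmul (k : K) (v : V) (w : W) :
    tmul K A (k • v) w = k • tmul K A v w := by
  simp [tmul, ← TensorProduct.smul_tmul']

theorem tmul_zero (v : V) : tmul K A v (0 : W) = 0 := by
  simp [tmul]

theorem zero_tmul (w : W) : tmul K A (0 : V) w = 0 := by
  simp [tmul]

variable {K A}

theorem hom_ext {X : Type w₃} [AddCommGroup X] [Module K X]
    {f g : BTensor K A V W →ₗ[K] X} (h : ∀ v w, f (tmul K A v w) = g (tmul K A v w)) :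
    f = g := by
  have : f ∘ₗ proj K A V W = g ∘ₗ proj K A V W := TensorProduct.ext' h
  ext x
  obtain ⟨y, rfl⟩ := Submodule.mkQ_surjective (balanceRel K A V W) x
  exact LinearMap.congr_fun this y

/-- The universal property: a `K`-bilinear `A`-balanced map factors through `V ⊗_A W`. -/
noncomputable def lift {X : Type w₃} [AddCommGroup X] [Module K X] (f : V →ₗ[K] W →ₗ[K] X)
    (hf : ∀ (v : V) (a : A) (w : W), f (op a • v) w = f v (a • w)) :
    BTensor K A V W →ₗ[K] X :=
  (balanceRel K A V W).liftQ (TensorProduct.lift f) (by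
    refine Submodule.span_le.2 ?_
    rintro _ ⟨v, a, w, rfl⟩
    simp [hf])

@[simp] theorem lift_tmul {X : Type w₃} [AddCommGroup X] [Module K X] (f : V →ₗ[K] W →ₗ[K] X)
    (hf : ∀ (v : V) (a : A) (w : W), f (op a • v) w = f v (a • w)) (v : V) (w : W) :
    lift f hf (tmul K A v w) = f v w :=
  (Submodule.liftQ_apply (balanceRel K A V W) (TensorProduct.lift f) (v ⊗ₜ[K] w)).trans
    (TensorProduct.lift.tmul v w)

section Functoriality

variable {V' : Type w₃} [AddCommGroup V'] [Module K V'] [Module Aᵐᵒᵖ V']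
  {W' : Type w₄} [AddCommGroup W'] [Module K W'] [Module A W']

/-- `f ⊗_A g` for a right `A`-linear map `f` and a left `A`-linear map `g`. -/
noncomputable def map (f : V →ₗ[K] V') (g : W →ₗ[K] W')
    (hf : ∀ (a : A) (v : V), f (op a • v) = op a • f v)
    (hg : ∀ (a : A) (w : W), g (a • w) = a • g w) :
    BTensor K A V W →ₗ[K] BTensor K A V' W' :=
  lift (((TensorProduct.mk K V' W').compl₁₂ f g).compr₂ (proj K A V' W')) (by
    intro v a w
    have := tmul_balance K A (f v) a (g w)
    simpa [hf, hg, tmul] using this)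

@[simp] theorem map_tmul (f : V →ₗ[K] V') (g : W →ₗ[K] W')
    (hf : ∀ (a : A) (v : V), f (op a • v) = op a • f v)
    (hg : ∀ (a : A) (w : W), g (a • w) = a • g w) (v : V) (w : W) :
    map f g hf hg (tmul K A v w) = tmul K A (f v) (g w) :=
  lift_tmul _ _ v w

end Functoriality

/-! The `A`-bimodule structure `a (v ⊗ w) b = (a v) ⊗ (w b)` of `V ⊗_A W`. -/

section LeftAction

variable (K A V W)
variable [Algebra K A] [Module A V] [SMulCommClass A Aᵐᵒᵖ V] [IsScalarTower K A V]

/-- The left action of `A` on `V ⊗_A W` through `V`. -/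
noncomputable def leftAction : A →+* Module.End K (BTensor K A V W) where
  toFun a := map (Algebra.lsmul K K V a) LinearMap.id
    (fun b v => by simpa using smul_comm a (op b) v) (fun _ _ => rfl)
  map_one' := hom_ext fun v w => by simp
  map_mul' a b := hom_ext fun v w => by simp
  map_zero' := hom_ext fun v w => by rw [map_tmul]; simp [zero_tmul]
  map_add' a b := hom_ext fun v w => by rw [map_tmul]; simp [add_tmul]

noncomputable instance : Module A (BTensor K A V W) :=
  Module.compHom (BTensor K A V W) (leftAction K A V W)

variable {V W}

theorem left_smul_tmul (a : A) (v : V) (w : W) :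
    a • tmul K A v w = tmul K A (a • v) w := by
  change leftAction K A V W a (tmul K A v w) = _
  simp [leftAction]

instance : IsScalarTower K A (BTensor K A V W) where
  smul_assoc k a x := by
    have h : leftAction K A V W (k • a) = k • leftAction K A V W a :=
      hom_ext fun v w => by simp [leftAction, smul_tmul]
    exact LinearMap.congr_fun h x

end LeftAction

section RightAction

variable (K A V W)
variable [Algebra K A] [Module Aᵐᵒᵖ W] [SMulCommClass A Aᵐᵒᵖ W] [IsScalarTower K Aᵐᵒᵖ W]

/-- The right action of `A` on `V ⊗_A W` through `W`. -/
noncomputable def rightAction : Aᵐᵒᵖ →+* Module.End K (BTensor K A V W) where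
  toFun a := map LinearMap.id (Algebra.lsmul K K W a)
    (fun _ _ => rfl) (fun b w => by simpa using (smul_comm b a w).symm)
  map_one' := hom_ext fun v w => by simp
  map_mul' a b := hom_ext fun v w => by simp
  map_zero' := hom_ext fun v w => by rw [map_tmul]; simp [tmul_zero]
  map_add' a b := hom_ext fun v w => by rw [map_tmul]; simp [tmul_add]

noncomputable instance : Module Aᵐᵒᵖ (BTensor K A V W) :=
  Module.compHom (BTensor K A V W) (rightAction K A V W)

variable {V W}

theorem right_smul_tmul (a : Aᵐᵒᵖ) (v : V) (w : W) :
    a • tmul K A v w = tmul K A v (a • w) := by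
  change rightAction K A V W a (tmul K A v w) = _
  simp [rightAction]

instance : IsScalarTower K Aᵐᵒᵖ (BTensor K A V W) where
  smul_assoc k a x := by
    have h : rightAction K A V W (k • a) = k • rightAction K A V W a :=
      hom_ext fun v w => by simp [rightAction, tmul_smul]
    exact LinearMap.congr_fun h x

instance [Module A V] [SMulCommClass A Aᵐᵒᵖ V] [IsScalarTower K A V] :
    SMulCommClass A Aᵐᵒᵖ (BTensor K A V W) where
  smul_comm a b x := by
    have h : leftAction K A V W a ∘ₗ rightAction K A V W b =
        rightAction K A V W b ∘ₗ leftAction K A V W a :=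
      hom_ext fun v w => by simp [leftAction, rightAction]
    exact LinearMap.congr_fun h x

end RightAction

section Associator

variable (K A V W)
variable [Algebra K A] [Module Aᵐᵒᵖ W] [SMulCommClass A Aᵐᵒᵖ W] [IsScalarTower K A W]
  [IsScalarTower K Aᵐᵒᵖ W]
variable (U : Type w₃) [AddCommGroup U] [Module K U] [Module A U]

/-- The map `v ⊗ w ↦ (u ↦ v ⊗ (w ⊗ u))`. -/
noncomputable def assocAux : BTensor K A V W →ₗ[K] U →ₗ[K] BTensor K A V (BTensor K A W U) :=
  lift
    (LinearMap.mk₂ K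
      (fun v w =>
        ({ toFun := fun u => tmul K A v (tmul K A w u)
           map_add' := fun u u' => by simp [tmul_add]
           map_smul' := fun k u => by simp [tmul_smul] } :
          U →ₗ[K] BTensor K A V (BTensor K A W U)))
      (fun v v' w => by ext u; simp [add_tmul])
      (fun k v w => by ext u; simp [smul_tmul])
      (fun v w w' => by ext u; simp [add_tmul, tmul_add])
      (fun k v w => by ext u; simp [smul_tmul, tmul_smul]))
    (fun v a w => by
      ext u
      simp [tmul_balance, left_smul_tmul])

/-- The canonical isomorphism `(V ⊗_A W) ⊗_A U → V ⊗_A (W ⊗_A U)`,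
`(v ⊗ w) ⊗ u ↦ v ⊗ (w ⊗ u)`. -/
noncomputable def assoc :
    BTensor K A (BTensor K A V W) U →ₗ[K] BTensor K A V (BTensor K A W U) :=
  lift (assocAux K A V W U) (by
    intro x a u
    have h : ((assocAux K A V W U).flip u) ∘ₗ rightAction K A V W (op a) =
        (assocAux K A V W U).flip (a • u) :=
      hom_ext fun v w => by simp [assocAux, rightAction, tmul_balance]
    exact LinearMap.congr_fun h x)

@[simp] theorem assoc_tmul (v : V) (w : W) (u : U) :
    assoc K A V W U (tmul K A (tmul K A v w) u) = tmul K A v (tmul K A w u) := by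
  simp [assoc, assocAux]

end Associator

end BTensor

end Tensor

section Bocs

variable (K : Type v) [Field K] (A : Type u) [Ring A] [Algebra K A]
  (W : Type w₁) [AddCommGroup W] [Module K W] [Module A W] [Module Aᵐᵒᵖ W]
  [SMulCommClass A Aᵐᵒᵖ W] [IsScalarTower K A W] [IsScalarTower K Aᵐᵒᵖ W]

/-- A bocs structure on `(A, W)`, that is, an `A`-coring structure on the `A`-bimodule `W`:
bimodule maps `μ : W → W ⊗_A W` and `ε : W → A` such that `(1 ⊗ ε) μ` and `(ε ⊗ 1) μ` are the
canonical maps `w ↦ w ⊗ 1` and `w ↦ 1 ⊗ w`, and `(μ ⊗ 1) μ = (1 ⊗ μ) μ`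
(up to the canonical associativity isomorphism). -/
structure Bocs where
  comul : BimoduleHom K A W (BTensor K A W W)
  counit : BimoduleHom K A W A
  id_counit_comul : ∀ w : W,
    BTensor.map (A := A) LinearMap.id counit.toLinearMap (fun _ _ => rfl) counit.map_left
      (comul.toLinearMap w) = BTensor.tmul K A w (1 : A)
  counit_id_comul : ∀ w : W,
    BTensor.map (A := A) counit.toLinearMap LinearMap.id counit.map_right (fun _ _ => rfl)
      (comul.toLinearMap w) = BTensor.tmul K A (1 : A) w
  coassoc : ∀ w : W,
    BTensor.assoc K A W W W
      (BTensor.map (A := A) comul.toLinearMap LinearMap.id comul.map_right (fun _ _ => rfl)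
        (comul.toLinearMap w)) =
    BTensor.map (A := A) LinearMap.id comul.toLinearMap (fun _ _ => rfl) comul.map_left
      (comul.toLinearMap w)

end Bocs

section Dual

variable (K : Type v) [Field K] (A : Type u) [Ring A] [Algebra K A]

/-- The `A`-bimodule `D(A) = Hom_K(A, K)`. -/
def DualBimodule : Type max u v := Module.Dual K A

namespace DualBimodule

noncomputable instance : AddCommGroup (DualBimodule K A) :=
  inferInstanceAs (AddCommGroup (Module.Dual K A))

noncomputable instance : Module K (DualBimodule K A) :=
  inferInstanceAs (Module K (Module.Dual K A))

instance : FunLike (DualBimodule K A) A K := inferInstanceAs (FunLike (Module.Dual K A) A K)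

/-- The left action `(a f)(x) = f (x a)`. -/
noncomputable instance : Module A (DualBimodule K A) where
  smul a f := (f : Module.Dual K A) ∘ₗ LinearMap.mulRight K a
  one_smul f := LinearMap.ext fun x => congrArg f (mul_one x)
  mul_smul a b f := LinearMap.ext fun x => congrArg f (mul_assoc x a b).symm
  smul_zero _ := rfl
  smul_add _ _ _ := rfl
  add_smul a b f := LinearMap.ext fun x =>
    (congrArg f (mul_add x a b)).trans ((f : Module.Dual K A).map_add _ _)
  zero_smul f := LinearMap.ext fun x =>
    (congrArg f (mul_zero x)).trans (f : Module.Dual K A).map_zero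

/-- The right action `(f b)(x) = f (b x)`. -/
noncomputable instance : Module Aᵐᵒᵖ (DualBimodule K A) where
  smul b f := (f : Module.Dual K A) ∘ₗ LinearMap.mulLeft K b.unop
  one_smul f := LinearMap.ext fun x => congrArg f (one_mul x)
  mul_smul a b f := LinearMap.ext fun x => congrArg f (mul_assoc b.unop a.unop x)
  smul_zero _ := rfl
  smul_add _ _ _ := rfl
  add_smul a b f := LinearMap.ext fun x =>
    (congrArg f (add_mul a.unop b.unop x)).trans ((f : Module.Dual K A).map_add _ _)
  zero_smul f := LinearMap.ext fun x =>
    (congrArg f (zero_mul x)).trans (f : Module.Dual K A).map_zero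

variable {K A}

theorem left_smul_apply (a : A) (f : DualBimodule K A) (x : A) : (a • f) x = f (x * a) := rfl

theorem right_smul_apply (b : A) (f : DualBimodule K A) (x : A) :
    (op b • f) x = f (b * x) := rfl

instance : SMulCommClass A Aᵐᵒᵖ (DualBimodule K A) where
  smul_comm a b f := LinearMap.ext fun x => congrArg f (mul_assoc b.unop x a).symm

instance : IsScalarTower K A (DualBimodule K A) where
  smul_assoc k a f := LinearMap.ext fun x =>
    (congrArg f (mul_smul_comm k x a)).trans ((f : Module.Dual K A).map_smul k _)

instance : IsScalarTower K Aᵐᵒᵖ (DualBimodule K A) where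
  smul_assoc k a f := LinearMap.ext fun x =>
    (congrArg f (smul_mul_assoc k a.unop x)).trans ((f : Module.Dual K A).map_smul k _)

end DualBimodule

end Dual

section Gendo

/-- A finite-dimensional algebra `B` is symmetric if `B ≅ D(B)` as `B`-bimodules. -/
def IsSymmetricAlgebra (K : Type v) [Field K] (B : Type u) [Ring B] [Algebra K B] : Prop :=
  Module.Finite K B ∧
    ∃ φ : BimoduleHom K B B (DualBimodule K B), Function.Bijective φ.toLinearMap

/-- A right `B`-module `M` is a generator if the regular module `B_B` is a direct summand of a
finite direct sum of copies of `M`. -/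
def IsGenerator (B : Type u) [Ring B] (M : Type w₁) [AddCommGroup M] [Module Bᵐᵒᵖ M] : Prop :=
  ∃ (n : ℕ) (i : B →ₗ[Bᵐᵒᵖ] (Fin n → M)) (p : (Fin n → M) →ₗ[Bᵐᵒᵖ] B), p ∘ₗ i = LinearMap.id

/-- A finite-dimensional algebra is gendo-symmetric if it is isomorphic to the endomorphism algebra
of a generator `M` of the category of finite-dimensional right modules over some
finite-dimensional symmetric algebra `B`. -/
def IsGendoSymmetric (K : Type v) [Field K] (A : Type u) [Ring A] [Algebra K A] : Prop :=
  ∃ (B : Type u) (_ : Ring B) (_ : Algebra K B) (M : Type u) (_ : AddCommGroup M)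
    (_ : Module K M) (_ : Module Bᵐᵒᵖ M) (_ : IsScalarTower K Bᵐᵒᵖ M),
    IsSymmetricAlgebra K B ∧ Module.Finite K M ∧ IsGenerator B M ∧
      Nonempty (A ≃ₐ[K] Module.End Bᵐᵒᵖ M)

end Gendo

end BocsTheory

/-! Let ε be the counit of a bocs on D(A). An endomorphism of D(A) that is linear on one side is
multiplication by an element of A on the other. Contracting μ with a one-sided linear map D(A) → A
therefore shows that this map is a multiple of ε (`exists_eq_counit_mul`, `exists_eq_mul_counit`). A
functional on D(A) ⊗_A D(A) amounts to a left linear map D(A) → A, so it has the form x ↦ ((1 ⊗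
ε)x)(a); if it kills the image of μ, then a = 0. Hence μ is onto, and it is injective by the counit
law. Both contractions against ε invert μ, so they agree, and f(ε(g)) is a symmetric form
(`apply_counit_comm`).

The image I of ε is an idempotent two-sided ideal with zero left annihilator, so I = AeA for an
idempotent e ∈ I (`exists_idempotent_generator`). If e = ε(t), then t restricts to a nondegenerate
trace form on B = eAe, and M = Ae is a generator over B. An endomorphism of Ae extends to a right
linear map on AeA; composed with ε it becomes a·ε, so it is left multiplication by a, and A ≅
End_B(M).

Conversely, if A ≅ End_B(M), matrix coefficients identify D(A) with M ⊗_B D(M), and the symmetric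
form of B gives a pairing ⟨ , ⟩ : D(M) × M → B. As M is a generator, Σ ⟨f_i, u_i⟩ = 1 for suitable
f_i and u_i. The comatrix formulas ε(m ⊗ g) = (x ↦ m⟨g, x⟩) and μ(m ⊗ g) = Σ (m ⊗ f_i) ⊗ (u_i ⊗ g)
then define a bocs (`nonempty_bocs_of_pairing`). -/

namespace BocsTheory

universe u v w₁

/-! ### Functionals and one-sided endomorphisms of D(A). -/

namespace DualBimodule

variable {K : Type v} [Field K] {A : Type u} [Ring A] [Algebra K A]

theorem add_apply (f g : DualBimodule K A) (x : A) : (f + g) x = f x + g x := rfl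

theorem smul_apply (k : K) (f : DualBimodule K A) (x : A) : (k • f) x = k * f x := rfl

theorem map_add (f : DualBimodule K A) (x y : A) : f (x + y) = f x + f y :=
  LinearMap.map_add (f : Module.Dual K A) x y

theorem map_zero (f : DualBimodule K A) : f 0 = 0 :=
  LinearMap.map_zero (f : Module.Dual K A)

theorem map_smul (f : DualBimodule K A) (k : K) (x : A) : f (k • x) = k * f x :=
  LinearMap.map_smul (f : Module.Dual K A) k x

theorem ext {f g : DualBimodule K A} (h : ∀ x, f x = g x) : f = g := LinearMap.ext h

instance [Module.Finite K A] : Module.Finite K (DualBimodule K A) :=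
  inferInstanceAs (Module.Finite K (Module.Dual K A))

theorem eq_of_forall_apply_eq {a b : A} (h : ∀ f : DualBimodule K A, f a = f b) : a = b :=
  sub_eq_zero.1 <| (Module.forall_dual_apply_eq_zero_iff K (a - b)).1 fun f => by
    rw [_root_.map_sub, sub_eq_zero]; exact h f

/-- Every functional on `D(A)` is the evaluation at an element of `A`. -/
theorem exists_eval [Module.Finite K A] (h : DualBimodule K A →ₗ[K] K) :
    ∃ a : A, ∀ f : DualBimodule K A, h f = f a := by
  obtain ⟨a, ha⟩ := (Module.evalEquiv K A).surjective h
  exact ⟨a, fun f => (LinearMap.congr_fun ha f).symm⟩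

/-- A right `A`-linear endomorphism of `D(A)` is the left multiplication by an element of `A`. -/
theorem exists_eq_left_smul [Module.Finite K A] (T : DualBimodule K A →ₗ[K] DualBimodule K A)
    (hT : ∀ (a : A) (f : DualBimodule K A), T (op a • f) = op a • T f) :
    ∃ a : A, ∀ f, T f = a • f := by
  let h : DualBimodule K A →ₗ[K] K :=
    { toFun := fun f => T f 1
      map_add' := fun f g => by rw [T.map_add]; rfl
      map_smul' := fun k f => by rw [T.map_smul]; rfl }
  obtain ⟨a, ha⟩ := exists_eval h
  refine ⟨a, fun f => ext fun x => ?_⟩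
  -- The value of T f at x is the value of (T f)x = T(f x) at 1.
  have := ha (op x • f)
  change T (op x • f) 1 = _ at this
  rw [hT, right_smul_apply, right_smul_apply, mul_one] at this
  rw [this, left_smul_apply]

/-- A left `A`-linear endomorphism of `D(A)` is the right multiplication by an element of `A`. -/
theorem exists_eq_right_smul [Module.Finite K A] (T : DualBimodule K A →ₗ[K] DualBimodule K A)
    (hT : ∀ (a : A) (f : DualBimodule K A), T (a • f) = a • T f) :
    ∃ a : A, ∀ f, T f = op a • f := by
  let h : DualBimodule K A →ₗ[K] K :=
    { toFun := fun f => T f 1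
      map_add' := fun f g => by rw [T.map_add]; rfl
      map_smul' := fun k f => by rw [T.map_smul]; rfl }
  obtain ⟨a, ha⟩ := exists_eval h
  refine ⟨a, fun f => ext fun x => ?_⟩
  have := ha (x • f)
  change T (x • f) 1 = _ at this
  rw [hT, left_smul_apply, left_smul_apply, one_mul] at this
  rw [this, right_smul_apply]

end DualBimodule

/-! ### Contractions of W ⊗_A W against maps W → A. -/

namespace BTensor

@[elab_as_elim]
theorem induction {K : Type v} [Field K] {A : Type u} [Ring A]
    {V : Type*} [AddCommGroup V] [Module K V] [Module Aᵐᵒᵖ V]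
    {U : Type*} [AddCommGroup U] [Module K U] [Module A U]
    {P : BTensor K A V U → Prop} (x : BTensor K A V U)
    (tmul : ∀ v u, P (tmul K A v u)) (add : ∀ x y, P x → P y → P (x + y)) : P x := by
  obtain ⟨y, rfl⟩ := Submodule.mkQ_surjective (balanceRel K A V U) x
  induction y using TensorProduct.induction_on with
  | zero =>
    have := tmul 0 0
    rw [tmul_zero] at this
    rwa [_root_.map_zero]
  | tmul v u => exact tmul v u
  | add y z hy hz => rw [map_add]; exact add _ _ hy hz

theorem tmul_sum {K : Type v} [Field K] {A : Type u} [Ring A] {V : Type*} [AddCommGroup V]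
    [Module K V] [Module Aᵐᵒᵖ V] {U : Type*} [AddCommGroup U] [Module K U] [Module A U]
    {ι : Type*} (s : Finset ι) (v : V) (w : ι → U) :
    tmul K A v (∑ i ∈ s, w i) = ∑ i ∈ s, tmul K A v (w i) :=
  map_sum (proj K A V U ∘ₗ TensorProduct.mk K V U v) w s

theorem sum_tmul {K : Type v} [Field K] {A : Type u} [Ring A] {V : Type*} [AddCommGroup V]
    [Module K V] [Module Aᵐᵒᵖ V] {U : Type*} [AddCommGroup U] [Module K U] [Module A U]
    {ι : Type*} (s : Finset ι) (v : ι → V) (w : U) :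
    tmul K A (∑ i ∈ s, v i) w = ∑ i ∈ s, tmul K A (v i) w :=
  map_sum (proj K A V U ∘ₗ (TensorProduct.mk K V U).flip w) v s

section

variable {K : Type v} [Field K] {A : Type u} [Ring A] [Algebra K A]
  {W : Type w₁} [AddCommGroup W] [Module K W] [Module Aᵐᵒᵖ W] [IsScalarTower K Aᵐᵒᵖ W]

/-- The canonical map `W ⊗_A A → W`. -/
noncomputable def rid : BTensor K A W A →ₗ[K] W :=
  lift ((Algebra.lsmul K K W).toLinearMap ∘ₗ (MulOpposite.opLinearEquiv K).toLinearMap).flip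
    (fun v a w => by simp)

@[simp] theorem rid_tmul (w : W) (a : A) : rid (tmul K A w a) = op a • w :=
  (lift_tmul _ _ w a).trans (by simp)

/-- The map `w ⊗ w' ↦ w φ(w')` for a left `A`-linear map `φ : W → A`. -/
noncomputable def contractRight [Module A W] (φ : W →ₗ[K] A)
    (hφ : ∀ (a : A) (w : W), φ (a • w) = a • φ w) :
    BTensor K A W W →ₗ[K] W :=
  rid ∘ₗ map LinearMap.id φ (fun _ _ => rfl) hφ

@[simp] theorem contractRight_tmul [Module A W] (φ : W →ₗ[K] A)
    (hφ : ∀ (a : A) (w : W), φ (a • w) = a • φ w) (w w' : W) :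
    contractRight φ hφ (tmul K A w w') = op (φ w') • w := by
  simp [contractRight]

end

section

variable {K : Type v} [Field K] {A : Type u} [Ring A] [Algebra K A]
  {W : Type w₁} [AddCommGroup W] [Module K W] [Module A W] [IsScalarTower K A W]

/-- The canonical map `A ⊗_A W → W`. -/
noncomputable def lid : BTensor K A A W →ₗ[K] W :=
  lift (Algebra.lsmul K K W).toLinearMap (fun v a w => by simp)

@[simp] theorem lid_tmul (a : A) (w : W) : lid (tmul K A a w) = a • w :=
  (lift_tmul _ _ a w).trans rfl

/-- The map `w ⊗ w' ↦ φ(w) w'` for a right `A`-linear map `φ : W → A`. -/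
noncomputable def contractLeft [Module Aᵐᵒᵖ W] (φ : W →ₗ[K] A)
    (hφ : ∀ (a : A) (w : W), φ (op a • w) = op a • φ w) :
    BTensor K A W W →ₗ[K] W :=
  lid ∘ₗ map φ LinearMap.id hφ (fun _ _ => rfl)

@[simp] theorem contractLeft_tmul [Module Aᵐᵒᵖ W] (φ : W →ₗ[K] A)
    (hφ : ∀ (a : A) (w : W), φ (op a • w) = op a • φ w) (w w' : W) :
    contractLeft φ hφ (tmul K A w w') = φ w • w' := by
  simp [contractLeft]

end

variable {K : Type v} [Field K] {A : Type u} [Ring A] [Algebra K A]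
  {W : Type w₁} [AddCommGroup W] [Module K W] [Module A W] [Module Aᵐᵒᵖ W]
  [IsScalarTower K A W] [IsScalarTower K Aᵐᵒᵖ W]

/-- Both sides send v ⊗ w to ψ(v)φ(w). This exchange law is what lets the counit determine all
one-sided linear maps. -/
theorem apply_contractRight (φ ψ : W →ₗ[K] A) (hφ : ∀ (a : A) (w : W), φ (a • w) = a • φ w)
    (hψ : ∀ (a : A) (w : W), ψ (op a • w) = op a • ψ w) (x : BTensor K A W W) :
    ψ (contractRight φ hφ x) = φ (contractLeft ψ hψ x) := by
  induction x using induction with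
  | tmul v w => simp [hφ, hψ]
  | add x y hx hy => simp only [map_add, hx, hy]

variable [SMulCommClass A Aᵐᵒᵖ W]

theorem contractRight_smul (φ : W →ₗ[K] A) (hφ : ∀ (a : A) (w : W), φ (a • w) = a • φ w)
    (a : A) (x : BTensor K A W W) :
    contractRight φ hφ (a • x) = a • contractRight φ hφ x := by
  induction x using induction with
  | tmul v w => simp [left_smul_tmul, smul_comm]
  | add x y hx hy => rw [smul_add, map_add, map_add, hx, hy, smul_add]

theorem contractLeft_smul (φ : W →ₗ[K] A) (hφ : ∀ (a : A) (w : W), φ (op a • w) = op a • φ w)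
    (a : Aᵐᵒᵖ) (x : BTensor K A W W) :
    contractLeft φ hφ (a • x) = a • contractLeft φ hφ x := by
  induction x using induction with
  | tmul v w => simp [right_smul_tmul, smul_comm]
  | add x y hx hy => rw [smul_add, map_add, map_add, hx, hy, smul_add]

end BTensor

/-! ### The counit and comultiplication of a bocs on D(A). -/

namespace Bocs

variable {K : Type v} [Field K] {A : Type u} [Ring A] [Algebra K A]

section General

variable {W : Type w₁} [AddCommGroup W] [Module K W] [Module A W] [Module Aᵐᵒᵖ W]
  [SMulCommClass A Aᵐᵒᵖ W] [IsScalarTower K A W] [IsScalarTower K Aᵐᵒᵖ W] (S : Bocs K A W)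

theorem contractRight_comul (w : W) :
    BTensor.contractRight S.counit.toLinearMap S.counit.map_left (S.comul.toLinearMap w) = w := by
  simp [BTensor.contractRight, S.id_counit_comul]

theorem contractLeft_comul (w : W) :
    BTensor.contractLeft S.counit.toLinearMap S.counit.map_right (S.comul.toLinearMap w) = w := by
  simp [BTensor.contractLeft, S.counit_id_comul]

theorem comul_injective : Function.Injective S.comul.toLinearMap :=
  Function.LeftInverse.injective S.contractRight_comul

end General

variable (S : Bocs K A (DualBimodule K A))

/-- Writing f = Σ ε(f₁)f₂ by the counit law, f(a) = Σ f₂(aε(f₁)) vanishes for every f. -/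
theorem eq_zero_of_mul_counit_eq_zero {a : A}
    (h : ∀ f, a * S.counit.toLinearMap f = 0) : a = 0 := by
  have key : ∀ x : BTensor K A (DualBimodule K A) (DualBimodule K A),
      BTensor.contractLeft S.counit.toLinearMap S.counit.map_right x a = 0 := by
    intro x
    induction x using BTensor.induction with
    | tmul f g => rw [BTensor.contractLeft_tmul, DualBimodule.left_smul_apply, h,
        DualBimodule.map_zero]
    | add x y hx hy => rw [map_add, DualBimodule.add_apply, hx, hy, add_zero]
  refine DualBimodule.eq_of_forall_apply_eq (K := K) fun f => ?_
  have := key (S.comul.toLinearMap f)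
  rwa [contractLeft_comul, ← DualBimodule.map_zero f] at this

/-- The image of the counit, as a left ideal. -/
noncomputable def counitIdeal : Ideal A where
  __ := LinearMap.range S.counit.toLinearMap
  smul_mem' := by
    rintro a _ ⟨f, rfl⟩
    exact ⟨a • f, S.counit.map_left a f⟩

instance : S.counitIdeal.IsTwoSided where
  mul_mem_of_left := by
    rintro _ b ⟨f, rfl⟩
    exact ⟨op b • f, S.counit.map_right b f⟩

/-- Applying ε to f = Σ ε(f₁)f₂ gives ε(f) = Σ ε(f₁)ε(f₂). -/
theorem counitIdeal_le_mul_self : S.counitIdeal ≤ S.counitIdeal * S.counitIdeal := by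
  have key : ∀ x : BTensor K A (DualBimodule K A) (DualBimodule K A),
      S.counit.toLinearMap
        (BTensor.contractLeft S.counit.toLinearMap S.counit.map_right x) ∈
        S.counitIdeal * S.counitIdeal := by
    intro x
    induction x using BTensor.induction with
    | tmul f g =>
      rw [BTensor.contractLeft_tmul]
      have := S.counit.map_left (S.counit.toLinearMap f) g
      change S.counit.toLinearMap _ = _ * _ at this
      rw [this]
      exact Ideal.mul_mem_mul ⟨f, rfl⟩ ⟨g, rfl⟩
    | add x y hx hy => rw [map_add, map_add]; exact add_mem hx hy
  rintro _ ⟨f, rfl⟩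
  have := key (S.comul.toLinearMap f)
  rwa [contractLeft_comul] at this

variable [Module.Finite K A]

/-- Left `A`-linear maps `D(A) → A` are right multiples of the counit. -/
theorem exists_eq_counit_mul (φ : DualBimodule K A →ₗ[K] A)
    (hφ : ∀ (a : A) (w : DualBimodule K A), φ (a • w) = a • φ w) :
    ∃ a : A, ∀ f, φ f = S.counit.toLinearMap f * a := by
  obtain ⟨a, ha⟩ := DualBimodule.exists_eq_right_smul
    (BTensor.contractRight φ hφ ∘ₗ S.comul.toLinearMap) (fun a f => by
      have := S.comul.map_left a f
      simp only [AddHom.toFun_eq_coe, LinearMap.coe_toAddHom] at this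
      simp [this, BTensor.contractRight_smul])
  refine ⟨a, fun f => ?_⟩
  -- The exchange law and the counit law turn ε((1 ⊗ φ)μ(f)) into φ(f), while (1 ⊗ φ)μ(f) = f a.
  have h := BTensor.apply_contractRight φ S.counit.toLinearMap hφ S.counit.map_right
    (S.comul.toLinearMap f)
  rw [contractLeft_comul] at h
  rw [← h]
  exact (congrArg S.counit.toLinearMap (ha f)).trans (S.counit.map_right a f)

/-- Right `A`-linear maps `D(A) → A` are left multiples of the counit. -/
theorem exists_eq_mul_counit (φ : DualBimodule K A →ₗ[K] A)
    (hφ : ∀ (a : A) (w : DualBimodule K A), φ (op a • w) = op a • φ w) :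
    ∃ a : A, ∀ f, φ f = a * S.counit.toLinearMap f := by
  obtain ⟨a, ha⟩ := DualBimodule.exists_eq_left_smul
    (BTensor.contractLeft φ hφ ∘ₗ S.comul.toLinearMap) (fun a f => by
      have := S.comul.map_right a f
      simp only [AddHom.toFun_eq_coe, LinearMap.coe_toAddHom] at this
      simp [this, BTensor.contractLeft_smul])
  refine ⟨a, fun f => ?_⟩
  have h := BTensor.apply_contractRight S.counit.toLinearMap φ S.counit.map_left hφ
    (S.comul.toLinearMap f)
  rw [contractRight_comul] at h
  rw [h]
  exact (congrArg S.counit.toLinearMap (ha f)).trans (S.counit.map_left a f)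

/-- By duality it suffices that a functional h killing the image of μ is zero. -/
theorem comul_surjective : Function.Surjective S.comul.toLinearMap := by
  rw [← LinearMap.range_eq_top]
  by_contra hne
  obtain ⟨h, h0, hle⟩ := Submodule.exists_le_ker_of_lt_top _ (lt_top_iff_ne_top.2 hne)
  refine h0 (BTensor.hom_ext ?_)
  -- For fixed g, the functional f ↦ h(f ⊗ g) is evaluation at some φ(g) ∈ A; balancedness of the
  -- tensor product makes φ left linear.
  have key : ∀ g : DualBimodule K A, ∃ b : A, ∀ f : DualBimodule K A,
      h (BTensor.tmul K A f g) = f b := fun g =>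
    DualBimodule.exists_eval
      { toFun := fun f => h (BTensor.tmul K A f g)
        map_add' := fun f f' => by rw [BTensor.add_tmul, map_add]
        map_smul' := fun k f => by rw [BTensor.smul_tmul, map_smul]; rfl }
  choose φ hφ using key
  obtain ⟨a, ha⟩ := S.exists_eq_counit_mul
    { toFun := φ
      map_add' := fun g g' => DualBimodule.eq_of_forall_apply_eq fun f => by
        rw [← hφ, BTensor.tmul_add, map_add, hφ, hφ, DualBimodule.map_add]
      map_smul' := fun k g => DualBimodule.eq_of_forall_apply_eq fun f => by
        rw [← hφ, BTensor.tmul_smul, map_smul, hφ, RingHom.id_apply, DualBimodule.map_smul,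
          smul_eq_mul] }
    (fun a g => DualBimodule.eq_of_forall_apply_eq (K := K) fun f => by
      change f (φ (a • g)) = f (a * φ g)
      rw [← hφ, ← BTensor.tmul_balance, hφ, DualBimodule.right_smul_apply])
  change ∀ f, φ f = _ at ha
  have hx : ∀ x : BTensor K A (DualBimodule K A) (DualBimodule K A),
      h x = BTensor.contractRight S.counit.toLinearMap S.counit.map_left x a := by
    intro x
    induction x using BTensor.induction with
    | tmul f g =>
      rw [hφ, ha, BTensor.contractRight_tmul, DualBimodule.right_smul_apply]
    | add x y hx hy => rw [map_add, map_add, hx, hy, DualBimodule.add_apply]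
  have h0a : a = 0 := DualBimodule.eq_of_forall_apply_eq (K := K) fun f => by
    have : h (S.comul.toLinearMap f) = 0 := hle ⟨f, rfl⟩
    rw [hx, contractRight_comul] at this
    rw [this, DualBimodule.map_zero]
  intro f g
  rw [hφ, ha, h0a, mul_zero, DualBimodule.map_zero, LinearMap.zero_apply]

theorem comul_bijective : Function.Bijective S.comul.toLinearMap :=
  ⟨S.comul_injective, S.comul_surjective⟩

/-- The two contractions `D(A) ⊗_A D(A) → D(A)` against the counit coincide. -/
theorem smul_counit_eq (f g : DualBimodule K A) :
    op (S.counit.toLinearMap g) • f = S.counit.toLinearMap f • g := by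
  -- With f ⊗ g = μ(w), both contractions return w.
  obtain ⟨w, hw⟩ := S.comul_surjective (BTensor.tmul K A f g)
  have h₁ := S.contractRight_comul w
  have h₂ := S.contractLeft_comul w
  rw [hw] at h₁ h₂
  rw [BTensor.contractRight_tmul] at h₁
  rw [BTensor.contractLeft_tmul] at h₂
  rw [h₁, h₂]

theorem apply_counit_comm (f g : DualBimodule K A) :
    f (S.counit.toLinearMap g) = g (S.counit.toLinearMap f) := by
  have := congrArg (fun h : DualBimodule K A => h 1) (S.smul_counit_eq f g)
  simpa [DualBimodule.left_smul_apply, DualBimodule.right_smul_apply] using this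

end Bocs

/-! ### Idempotent ideals in finite-dimensional algebras. -/

section Idempotents

theorem isNilpotent_mul_swap {R : Type*} [Ring R] {a b : R} (h : IsNilpotent (a * b)) :
    IsNilpotent (b * a) := by
  obtain ⟨n, hn⟩ := h
  refine ⟨n + 1, ?_⟩
  have key : ∀ k : ℕ, (b * a) ^ (k + 1) = b * (a * b) ^ k * a := by
    intro k
    induction k with
    | zero => simp
    | succ k ih => rw [pow_succ, ih, pow_succ]; noncomm_ring
  rw [key, hn]
  simp

/-- A non-nilpotent element of a finite-dimensional algebra has a nonzero idempotent multiple
by an element commuting with it. -/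
theorem exists_idempotent_multiple (K : Type*) [Field K] {A : Type*} [Ring A] [Algebra K A]
    [Module.Finite K A] {x : A} (hx : ¬ IsNilpotent x) :
    ∃ y : A, Commute x y ∧ IsIdempotentElem (x * y) ∧ x * y ≠ 0 := by
  let _ : CommRing (Algebra.adjoin K {x}) := inferInstance
  have _ : IsArtinianRing (Algebra.adjoin K {x}) := IsArtinianRing.of_finite K _
  let r : Algebra.adjoin K {x} := ⟨x, Algebra.self_mem_adjoin_singleton K x⟩
  -- Stabilisation of the ideals (r^k) in K[x] gives r^n = r^(2n+1) z, so r·(r^n z) is an idempotent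
  -- fixing r^n; if it were zero, r would be nilpotent.
  obtain ⟨n, hn⟩ := IsArtinian.range_smul_pow_stabilizes (Algebra.adjoin K {x}) r
  have hmem : r ^ n • (1 : Algebra.adjoin K {x}) ∈
      LinearMap.range (r ^ (2 * n + 1) • LinearMap.id :
        Algebra.adjoin K {x} →ₗ[Algebra.adjoin K {x}] Algebra.adjoin K {x}) := by
    rw [← hn (2 * n + 1) (by omega)]
    exact ⟨1, rfl⟩
  obtain ⟨z, hz⟩ := hmem
  have hz : r ^ (2 * n + 1) * z = r ^ n := by simpa using hz
  have hrn : r ^ n * (r * (r ^ n * z)) = r ^ n := by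
    rw [← hz]
    simpa only [hz] using (by ring : r ^ n * (r * (r ^ n * z)) = r ^ (2 * n + 1) * z)
  refine ⟨(r ^ n * z : Algebra.adjoin K {x}), ?_, ?_, ?_⟩
  · exact congrArg Subtype.val (mul_comm r (r ^ n * z))
  · have : r * (r ^ n * z) * (r * (r ^ n * z)) = r * (r ^ n * z) := by
      calc _ = r * z * (r ^ n * (r * (r ^ n * z))) := by ring
        _ = _ := by rw [hrn]; ring
    exact congrArg Subtype.val this
  · intro h0
    have h0' : r * (r ^ n * z) = 0 := Subtype.ext h0
    rw [h0', mul_zero] at hrn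
    exact hx ⟨n, (congrArg Subtype.val hrn).symm⟩

/-- An idempotent two-sided ideal of a finite-dimensional algebra is generated by an idempotent. -/
theorem exists_idempotent_generator (K : Type*) [Field K] {A : Type*} [Ring A] [Algebra K A]
    [Module.Finite K A] (I : Ideal A) [I.IsTwoSided] (hI : I ≤ I * I) :
    ∃ e ∈ I, IsIdempotentElem e ∧ I ≤ Ideal.span (Set.range fun b => e * b) := by
  have _ : IsArtinianRing A := IsArtinianRing.of_finite K A
  have _ : IsNoetherian A A := isNoetherian_of_tower K inferInstance
  -- Choose an idempotent e ∈ I with Ae maximal.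
  obtain ⟨_, ⟨e, ⟨heI, he⟩, rfl⟩, hmax⟩ := set_has_maximal_iff_noetherian.2 ‹IsNoetherian A A›
    ((fun e : A => Ideal.span {e}) '' {e | e ∈ I ∧ IsIdempotentElem e})
    ⟨_, 0, ⟨I.zero_mem, IsIdempotentElem.zero⟩, rfl⟩
  refine ⟨e, heI, he, ?_⟩
  have hee : e * e = e := he
  set p : A := 1 - e with hp
  have hpp : p * p = p := he.one_sub
  have hep : e * p = 0 := by rw [hp, mul_sub, hee, mul_one, sub_self]
  have hpe : p * e = 0 := by rw [hp, sub_mul, hee, one_mul, sub_self]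
  -- A non-nilpotent p x p would yield a nonzero idempotent f ∈ I orthogonal to e, and A(e + f)
  -- would be strictly larger than Ae.
  have hnil : ∀ x ∈ I, IsNilpotent (p * x * p) := by
    intro x hx
    by_contra hnot
    obtain ⟨y, hxy, hidem, hne⟩ := exists_idempotent_multiple K hnot
    set f := p * x * p * y with hf
    have hef : e * f = 0 := by
      rw [hf, mul_assoc p, mul_assoc p, ← mul_assoc, hep, zero_mul]
    have hfe : f * e = 0 := by
      rw [hf, hxy.eq, mul_assoc, mul_assoc _ p, hpe, mul_zero, mul_zero]
    have hfI : f ∈ I := I.mul_mem_right _ (I.mul_mem_right _ (I.mul_mem_left _ hx))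
    have hff : f * f = f := hidem
    have hsum : IsIdempotentElem (e + f) := by
      change (e + f) * (e + f) = e + f
      rw [mul_add, add_mul, add_mul, hee, hef, hfe, hff, add_zero, zero_add]
    refine hmax _ ⟨e + f, ⟨I.add_mem heI hfI, hsum⟩, rfl⟩ ?_
    refine lt_of_le_not_ge ?_ fun hle => hne ?_
    · refine (Ideal.span_singleton_le_iff_mem _).2 (Ideal.mem_span_singleton'.2 ⟨e, ?_⟩)
      rw [mul_add, hee, hef, add_zero]
    · have hmem : f ∈ Ideal.span {e + f} :=
        Ideal.mem_span_singleton'.2 ⟨f, by rw [mul_add, hfe, hff, zero_add]⟩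
      obtain ⟨a, ha⟩ := Ideal.mem_span_singleton'.1 (hle hmem)
      rw [← hfe, ← ha, mul_assoc, hee, ha]
  have hjac : ∀ x ∈ I, p * x * p ∈ Ring.jacobson A := by
    intro x hx
    rw [← Ideal.jacobson_bot, Ideal.mem_jacobson_iff]
    intro a
    have h₁ : IsNilpotent (a * (p * x * p)) := by
      have h₂ := hnil (a * (p * x)) (I.mul_mem_left _ (I.mul_mem_left _ hx))
      rw [mul_assoc] at h₂
      have h₃ := isNilpotent_mul_swap h₂
      rw [mul_assoc, hpp] at h₃
      simpa only [mul_assoc] using h₃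
    obtain ⟨u, hu⟩ := h₁.isUnit_one_add
    refine ⟨(u⁻¹ : Aˣ), ?_⟩
    have : (↑u⁻¹ : A) * a * (p * x * p) + ↑u⁻¹ - 1 = ↑u⁻¹ * (1 + a * (p * x * p)) - 1 := by
      noncomm_ring
    rw [this, ← hu, Units.inv_mul, sub_self]
    exact Ideal.zero_mem _
  -- The left ideal generated by eA is the two-sided ideal AeA.
  set N : Ideal A := Ideal.span (Set.range fun b => e * b) with hN
  have hNmem : ∀ a b, a * e * b ∈ N := fun a b => by
    rw [mul_assoc]
    exact N.mul_mem_left _ (Ideal.subset_span ⟨b, rfl⟩)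
  have hNI : ∀ x ∈ N, ∀ y, x * y ∈ N := by
    intro x hx y
    induction hx using Submodule.span_induction with
    | mem x hx => obtain ⟨b, rfl⟩ := hx; exact Ideal.subset_span ⟨b * y, (mul_assoc _ _ _).symm⟩
    | zero => rw [zero_mul]; exact N.zero_mem
    | add x x' _ _ hx hx' => rw [add_mul]; exact N.add_mem hx hx'
    | smul a x _ hx => rw [smul_eq_mul, mul_assoc]; exact N.mul_mem_left _ hx
  have hIJ : I ≤ N ⊔ Ring.jacobson A := by
    intro x hx
    have : x = (1 * e * x + p * x * e * 1) + p * x * p := by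
      rw [hp]; noncomm_ring
    rw [this]
    exact Submodule.add_mem_sup (N.add_mem (hNmem _ _) (hNmem _ _)) (hjac x hx)
  -- Idempotence of I feeds I ≤ N + J into itself; iterating puts J^k in front of I, and J is
  -- nilpotent.
  have hstep : I ≤ N ⊔ Ring.jacobson A * I := by
    calc I ≤ I * I := hI
      _ ≤ (N ⊔ Ring.jacobson A) * I := Ideal.mul_mono_left hIJ
      _ = N * I ⊔ Ring.jacobson A * I := Ideal.sup_mul _ _ _
      _ ≤ _ := sup_le_sup_right (Ideal.mul_le.2 fun x hx y _ => hNI x hx y) _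
  have hpow : ∀ k : ℕ, I ≤ N ⊔ Ring.jacobson A ^ k * I := by
    intro k
    induction k with
    | zero =>
      rw [Submodule.pow_zero, Ideal.one_eq_top]
      intro x hx
      refine Submodule.mem_sup_right ?_
      simpa only [one_mul] using
        Ideal.mul_mem_mul (I := ⊤) (Submodule.mem_top (x := (1 : A))) hx
    | succ k ih =>
      refine ih.trans (sup_le le_sup_left ?_)
      refine (Ideal.mul_mono_right hstep).trans ?_
      rw [Ideal.mul_sup, ← mul_assoc, ← Submodule.pow_succ]
      exact sup_le_sup_right (Ideal.mul_le.2 fun x _ y hy => N.mul_mem_left x hy) _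
  obtain ⟨n, hn⟩ := IsSemiprimaryRing.isNilpotent (R := A)
  refine (hpow n).trans (sup_le le_rfl ?_)
  rw [hn]
  refine Ideal.mul_le.2 fun x hx y _ => ?_
  have : x = 0 := hx
  rw [this, zero_mul]
  exact N.zero_mem

end Idempotents

/-- The map q descends to the range of p, and over a field it extends from there to all of W. -/
theorem exists_comp_eq_of_ker_le_ker {K V W X : Type*} [Field K] [AddCommGroup V] [Module K V]
    [AddCommGroup W] [Module K W] [AddCommGroup X] [Module K X]
    (p : V →ₗ[K] W) (q : V →ₗ[K] X) (h : ∀ x, p x = 0 → q x = 0) :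
    ∃ r : W →ₗ[K] X, ∀ x, r (p x) = q x := by
  obtain ⟨r, hr⟩ := LinearMap.exists_extend
    ((LinearMap.ker p).liftQ q h ∘ₗ p.quotKerEquivRange.symm.toLinearMap)
  refine ⟨r, fun x => ?_⟩
  have := LinearMap.congr_fun hr ⟨p x, x, rfl⟩
  have hx : p.quotKerEquivRange.symm ⟨p x, x, rfl⟩ = (LinearMap.ker p).mkQ x := by
    rw [LinearEquiv.symm_apply_eq]
    rfl
  exact Eq.trans (by simpa [hx] using this) ((LinearMap.ker p).liftQ_apply q (h := h) x)

/-! ### The corner algebra eAe and the right eAe-module Ae. -/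

section Corner

variable (K : Type v) [Field K] {A : Type u} [Ring A] [Algebra K A] {e : A}

theorem mul_corner (he : IsIdempotentElem e) (x : he.Corner) : e * x.1 = x.1 :=
  ((Subsemigroup.mem_corner_iff he).1 x.2).1

theorem corner_mul (he : IsIdempotentElem e) (x : he.Corner) : x.1 * e = x.1 :=
  ((Subsemigroup.mem_corner_iff he).1 x.2).2

theorem corner_ext {he : IsIdempotentElem e} {x y : he.Corner} (h : x.1 = y.1) : x = y :=
  Subtype.ext h

/-- The element `e a e` of the corner ring `e A e`. -/
def toCorner (he : IsIdempotentElem e) (a : A) : he.Corner := ⟨e * a * e, a, rfl⟩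

instance {he : IsIdempotentElem e} : SMul K he.Corner where
  smul k x := ⟨k • x.1, (Subsemigroup.mem_corner_iff he).2
    ⟨by rw [mul_smul_comm, mul_corner], by rw [smul_mul_assoc, corner_mul]⟩⟩

/-- The inclusion of a corner ring. -/
def cornerVal (he : IsIdempotentElem e) : he.Corner →+ A where
  toFun x := x.1
  map_zero' := rfl
  map_add' _ _ := rfl

noncomputable instance (he : IsIdempotentElem e) : Module K he.Corner :=
  Function.Injective.module K (cornerVal he) Subtype.val_injective fun _ _ => rfl

noncomputable instance (he : IsIdempotentElem e) : Algebra K he.Corner :=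
  Algebra.ofModule (fun k x y => corner_ext (smul_mul_assoc k x.1 y.1))
    (fun k x y => corner_ext (mul_smul_comm k x.1 y.1))

/-- The inclusion of a corner ring as a linear map. -/
def cornerValₗ (he : IsIdempotentElem e) : he.Corner →ₗ[K] A where
  toFun x := x.1
  map_smul' _ _ := rfl
  map_add' _ _ := rfl

instance [Module.Finite K A] (he : IsIdempotentElem e) : Module.Finite K he.Corner :=
  Module.Finite.of_injective (cornerValₗ K he) Subtype.val_injective

/-- The left ideal `A e` generated by an idempotent, a right module over `e A e`. -/
def LeftCorner (_ : IsIdempotentElem e) : Submodule K A where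
  carrier := {x | x * e = x}
  add_mem' {x y} hx hy := by
    change (x + y) * e = x + y
    rw [add_mul, hx, hy]
  zero_mem' := zero_mul e
  smul_mem' k x hx := by
    change (k • x) * e = k • x
    rw [smul_mul_assoc, hx]

variable {K}

theorem leftCorner_mul {he : IsIdempotentElem e} (x : LeftCorner K he) : x.1 * e = x.1 := x.2

theorem mul_mem_leftCorner {he : IsIdempotentElem e} (a : A) {x : A} (hx : x ∈ LeftCorner K he) :
    a * x ∈ LeftCorner K he := by
  change a * x * e = a * x
  rw [mul_assoc]
  exact congrArg (a * ·) hx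

theorem idempotent_mem_leftCorner (he : IsIdempotentElem e) : e ∈ LeftCorner K he := he

noncomputable instance (he : IsIdempotentElem e) : Module he.Cornerᵐᵒᵖ (LeftCorner K he) where
  smul b x := ⟨x.1 * b.unop.1, mul_mem_leftCorner x.1 (corner_mul he b.unop)⟩
  one_smul x := Subtype.ext (leftCorner_mul x)
  mul_smul b c x := Subtype.ext (mul_assoc x.1 c.unop.1 b.unop.1).symm
  smul_zero _ := Subtype.ext (zero_mul _)
  smul_add _ _ _ := Subtype.ext (add_mul _ _ _)
  add_smul _ _ _ := Subtype.ext (mul_add _ _ _)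
  zero_smul _ := Subtype.ext (mul_zero _)

instance (he : IsIdempotentElem e) : IsScalarTower K he.Cornerᵐᵒᵖ (LeftCorner K he) where
  smul_assoc k b x := Subtype.ext (mul_smul_comm k x.1 b.unop.1)

/-- One copy of Ae suffices: left multiplication by e retracts Ae onto eAe. -/
theorem isGenerator_leftCorner (he : IsIdempotentElem e) :
    IsGenerator he.Corner (LeftCorner K he) :=
  ⟨1,
    { toFun := fun b _ => ⟨b.1, corner_mul he b⟩
      map_add' := fun _ _ => rfl
      map_smul' := fun _ _ => rfl },
    { toFun := fun x => ⟨e * (x 0).1, (x 0).1, by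
        change e * (x 0).1 * e = _
        rw [mul_assoc, leftCorner_mul]⟩
      map_add' := fun x y => corner_ext (mul_add e (x 0).1 (y 0).1)
      map_smul' := fun b x => corner_ext (mul_assoc e (x 0).1 b.unop.1).symm },
    LinearMap.ext fun b => corner_ext (mul_corner he b)⟩

/-- The corner algebra `e A e` is symmetric if some functional on `A` restricts to a
nondegenerate trace form on it. -/
theorem isSymmetricAlgebra_corner [Module.Finite K A] (he : IsIdempotentElem e)
    (t : DualBimodule K A) (hcomm : ∀ x y : he.Corner, t (x.1 * y.1) = t (y.1 * x.1))
    (hnondeg : ∀ x : he.Corner, (∀ y : he.Corner, t (x.1 * y.1) = 0) → x = 0) :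
    IsSymmetricAlgebra K he.Corner := by
  let φ : he.Corner →ₗ[K] DualBimodule K he.Corner :=
    { toFun := fun b => (
        { toFun := fun x => t (x.1 * b.1)
          map_add' := fun x y => (congrArg t (add_mul x.1 y.1 b.1)).trans
            (DualBimodule.map_add _ _ _)
          map_smul' := fun k x => (congrArg t (smul_mul_assoc k x.1 b.1)).trans
            (DualBimodule.map_smul _ _ _) } : Module.Dual K he.Corner)
      map_add' := fun b c => DualBimodule.ext fun x =>
        (congrArg t (mul_add x.1 b.1 c.1)).trans (DualBimodule.map_add _ _ _)
      map_smul' := fun k b => DualBimodule.ext fun x =>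
        (congrArg t (mul_smul_comm k x.1 b.1)).trans (DualBimodule.map_smul _ _ _) }
  have hφ : ∀ b x, φ b x = t (x.1 * b.1) := fun _ _ => rfl
  refine ⟨inferInstance, ⟨φ, fun a b => ?_, fun a b => ?_⟩, ?_⟩
  · exact DualBimodule.ext fun x => congrArg t (mul_assoc x.1 a.1 b.1).symm
  · refine DualBimodule.ext fun x => ?_
    change t (x.1 * (b.1 * a.1)) = t (a.1 * x.1 * b.1)
    have := hcomm (x * b) a
    change t (x.1 * b.1 * a.1) = t (a.1 * (x.1 * b.1)) at this
    rw [← mul_assoc, this, mul_assoc]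
  · have hinj : Function.Injective φ := by
      refine (injective_iff_map_eq_zero φ).2 fun b hb => hnondeg b fun y => ?_
      rw [hcomm, ← hφ, hb]
      rfl
    refine ⟨hinj, ?_⟩
    refine (LinearMap.injective_iff_surjective_of_finrank_eq_finrank (f := φ) ?_).1 hinj
    exact (Subspace.dual_finrank_eq (K := K) (V := he.Corner)).symm

/-- Left multiplication as an algebra homomorphism `A → End(A e)`. -/
noncomputable def toEndLeftCorner (he : IsIdempotentElem e) :
    A →ₐ[K] Module.End he.Cornerᵐᵒᵖ (LeftCorner K he) where
  toFun a :=
    { toFun := fun x => ⟨a * x.1, mul_mem_leftCorner a x.2⟩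
      map_add' := fun x y => Subtype.ext (mul_add a x.1 y.1)
      map_smul' := fun b x => Subtype.ext (mul_assoc a x.1 b.unop.1).symm }
  map_one' := LinearMap.ext fun x => Subtype.ext (one_mul x.1)
  map_mul' a b := LinearMap.ext fun x => Subtype.ext (mul_assoc a b x.1)
  map_zero' := LinearMap.ext fun x => Subtype.ext (zero_mul x.1)
  map_add' a b := LinearMap.ext fun x => Subtype.ext (add_mul a b x.1)
  commutes' k := LinearMap.ext fun x => Subtype.ext (Algebra.smul_def k x.1).symm

theorem toEndLeftCorner_apply_val (he : IsIdempotentElem e) (a : A) (x : LeftCorner K he) :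
    (toEndLeftCorner he a x).1 = a * x.1 := rfl

end Corner

/-! ### From a bocs on D(A) to a gendo-symmetric presentation. -/

namespace Bocs

variable {K : Type v} [Field K] {A : Type u} [Ring A] [Algebra K A] [Module.Finite K A]
  (S : Bocs K A (DualBimodule K A)) {e : A}

theorem isSymmetricAlgebra_corner (he : IsIdempotentElem e) (heI : e ∈ S.counitIdeal) :
    IsSymmetricAlgebra K he.Corner := by
  obtain ⟨t, ht⟩ := heI
  have hcorner : ∀ x : he.Corner, ∃ f, S.counit.toLinearMap f = x.1 := fun x => by
    refine ⟨op x.1 • t, (S.counit.map_right x.1 t).trans ?_⟩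
    exact (congrArg (· * x.1) ht).trans (mul_corner he x)
  -- By symmetry of the form, t(ε(f)y) = t(ε(f y)) = (f y)(ε(t)) = f(y e) = f(y).
  have ht_mul : ∀ (f : DualBimodule K A) (y : he.Corner),
      t (S.counit.toLinearMap f * y.1) = f y.1 := fun f y => by
    have h := S.counit.map_right y.1 f
    change S.counit.toLinearMap _ = S.counit.toLinearMap f * y.1 at h
    rw [← h, S.apply_counit_comm, DualBimodule.right_smul_apply]
    exact congrArg f ((congrArg (y.1 * ·) ht).trans (corner_mul he y))
  refine BocsTheory.isSymmetricAlgebra_corner he t (fun x y => ?_) (fun x hx => ?_)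
  · obtain ⟨f, hf⟩ := hcorner x
    obtain ⟨g, hg⟩ := hcorner y
    rw [← hf, ht_mul, hf, ← hg, ht_mul, ← hf, S.apply_counit_comm]
  · obtain ⟨f, hf⟩ := hcorner x
    -- Here f vanishes on eAe, so e f e = 0 and x = e ε(f) e = ε(e f e) = 0.
    have h0 : e • op e • f = 0 := DualBimodule.ext fun z => by
      rw [DualBimodule.left_smul_apply, DualBimodule.right_smul_apply, ← mul_assoc]
      have := hx (toCorner he z)
      rwa [← hf, ht_mul] at this
    have h₁ := S.counit.map_left e (op e • f)
    have h₂ := S.counit.map_right e f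
    change S.counit.toLinearMap _ = e * S.counit.toLinearMap _ at h₁
    change S.counit.toLinearMap _ = S.counit.toLinearMap f * e at h₂
    rw [h0, map_zero, h₂, hf, corner_mul, mul_corner] at h₁
    exact corner_ext h₁.symm

theorem toEndLeftCorner_bijective (he : IsIdempotentElem e) (heI : e ∈ S.counitIdeal)
    (hI : S.counitIdeal ≤ Ideal.span (Set.range fun b => e * b)) :
    Function.Bijective (toEndLeftCorner (K := K) he) := by
  -- Annihilating Ae means annihilating AeA, which contains the image of ε.
  have hzero : ∀ z : A, (∀ a, z * (a * e) = 0) → z = 0 := by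
    intro z hz
    refine S.eq_zero_of_mul_counit_eq_zero fun f => ?_
    have key : ∀ x ∈ Ideal.span (Set.range fun b => e * b), ∀ a, z * (a * x) = 0 := by
      intro x hx
      induction hx using Submodule.span_induction with
      | mem x hx =>
        obtain ⟨b, rfl⟩ := hx
        intro a
        rw [← mul_assoc a, ← mul_assoc z, hz, zero_mul]
      | zero => intro a; rw [mul_zero, mul_zero]
      | add x y _ _ hx hy => intro a; rw [mul_add, mul_add, hx, hy, add_zero]
      | smul c x _ hx => intro a; rw [smul_eq_mul, ← mul_assoc a, hx]
    simpa only [one_mul] using key _ (hI ⟨f, rfl⟩) 1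
  constructor
  · refine (injective_iff_map_eq_zero (toEndLeftCorner (K := K) he)).2 fun z hz =>
      hzero z fun a => ?_
    exact congrArg Subtype.val (LinearMap.congr_fun hz
      ⟨a * e, mul_mem_leftCorner a (idempotent_mem_leftCorner he)⟩)
  · intro ψ
    let p : LeftCorner K he ⊗[K] A →ₗ[K] A :=
      TensorProduct.lift ((LinearMap.mul K A) ∘ₗ (LeftCorner K he).subtype)
    let q : LeftCorner K he ⊗[K] A →ₗ[K] A :=
      TensorProduct.lift ((LinearMap.mul K A) ∘ₗ (LeftCorner K he).subtype ∘ₗ ψ.restrictScalars K)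
    -- This makes Σ xᵢyᵢ ↦ Σ ψ(xᵢ)yᵢ well defined: if Σ xᵢyᵢ = 0, then Σ ψ(xᵢ)yᵢ annihilates Ae,
    -- hence is zero.
    have hpq : ∀ (a : A) (z : LeftCorner K he ⊗[K] A), q z * (a * e) =
        (ψ ⟨p z * (a * e), mul_mem_leftCorner (p z)
          (mul_mem_leftCorner a (idempotent_mem_leftCorner he))⟩).1 := by
      intro a z
      induction z using TensorProduct.induction_on with
      | zero =>
        simp only [map_zero, zero_mul]
        exact (congrArg Subtype.val (map_zero ψ)).symm
      | tmul x y =>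
        have h := congrArg Subtype.val (ψ.map_smul (op (toCorner he (y * a))) x)
        have h₁ : op (toCorner he (y * a)) • x = ⟨p (x ⊗ₜ y) * (a * e), mul_mem_leftCorner _
            (mul_mem_leftCorner a (idempotent_mem_leftCorner he))⟩ := Subtype.ext <| by
          change x.1 * (e * (y * a) * e) = x.1 * y * (a * e)
          conv_rhs => rw [← leftCorner_mul x]
          simp only [mul_assoc]
        rw [h₁] at h
        rw [h]
        change (ψ x).1 * y * (a * e) = (ψ x).1 * (e * (y * a) * e)
        conv_lhs => rw [← leftCorner_mul (ψ x)]
        simp only [mul_assoc]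
      | add z w hz hw =>
        rw [map_add, add_mul, hz, hw, ← Submodule.coe_add, ← map_add]
        congr 2
        exact Subtype.ext (by simp only [map_add, add_mul]; rfl)
    obtain ⟨Ψ, hΨ⟩ := exists_comp_eq_of_ker_le_ker (V := LeftCorner K he ⊗[K] A) p q fun z hz =>
        hzero _ fun a => by
      rw [hpq]
      have : (⟨p z * (a * e), mul_mem_leftCorner (p z)
          (mul_mem_leftCorner a (idempotent_mem_leftCorner he))⟩ : LeftCorner K he) = 0 :=
        Subtype.ext ((congrArg (· * (a * e)) hz).trans (zero_mul _))
      rw [this, map_zero]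
      rfl
    have hΨ' : ∀ (x : LeftCorner K he) (y : A), Ψ (x.1 * y) = (ψ x).1 * y := fun x y => hΨ (x ⊗ₜ y)
    have hΨright : ∀ x ∈ Ideal.span (Set.range fun b => e * b), ∀ a b,
        Ψ (a * x * b) = Ψ (a * x) * b := by
      intro x hx
      induction hx using Submodule.span_induction with
      | mem x hx =>
        obtain ⟨c, rfl⟩ := hx
        intro a b
        have h := hΨ' ⟨a * e, mul_mem_leftCorner a (idempotent_mem_leftCorner he)⟩
        change ∀ y, Ψ (a * e * y) = _ at h
        change Ψ (a * (e * c) * b) = Ψ (a * (e * c)) * b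
        rw [← mul_assoc a, mul_assoc _ c, h, h, mul_assoc]
      | zero => intro a b; rw [mul_zero, zero_mul, map_zero, zero_mul]
      | add x y _ _ hx hy => intro a b; rw [mul_add, add_mul, map_add, hx, hy, map_add, add_mul]
      | smul c x _ hx => intro a b; rw [smul_eq_mul, ← mul_assoc a, hx]
    -- Right linearity of Ψ holds on AeA, which is enough because ε takes its values there.
    obtain ⟨a, ha⟩ := S.exists_eq_mul_counit (Ψ ∘ₗ S.counit.toLinearMap) (fun b f => by
      have h := S.counit.map_right b f
      change S.counit.toLinearMap _ = S.counit.toLinearMap f * b at h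
      have h₁ := hΨright _ (hI ⟨f, rfl⟩) 1 b
      rw [one_mul] at h₁
      change Ψ (S.counit.toLinearMap (op b • f)) = Ψ (S.counit.toLinearMap f) * b
      rw [h]
      exact h₁)
    refine ⟨a, LinearMap.ext fun x => Subtype.ext ?_⟩
    have hx : x.1 ∈ S.counitIdeal := by
      rw [← leftCorner_mul x]
      exact S.counitIdeal.mul_mem_left _ heI
    obtain ⟨f, hf⟩ := hx
    have h₁ := hΨ' x 1
    have h₂ := ha f
    change Ψ (S.counit.toLinearMap f) = a * S.counit.toLinearMap f at h₂
    change S.counit.toLinearMap f = x.1 at hf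
    rw [mul_one, mul_one] at h₁
    rw [toEndLeftCorner_apply_val, ← h₁, ← hf, h₂]

theorem isGendoSymmetric (S : Bocs K A (DualBimodule K A)) : IsGendoSymmetric K A := by
  obtain ⟨e, heI, he, hI⟩ := exists_idempotent_generator K S.counitIdeal S.counitIdeal_le_mul_self
  exact ⟨he.Corner, inferInstance, inferInstance, LeftCorner K he, inferInstance, inferInstance,
    inferInstance, inferInstance, S.isSymmetricAlgebra_corner he heI, inferInstance,
    isGenerator_leftCorner he, ⟨AlgEquiv.ofBijective _ (S.toEndLeftCorner_bijective he heI hI)⟩⟩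

end Bocs

/-! ### The pairing D(M) × M → B over a symmetric algebra. -/

section GeneratorPairing

variable {K : Type*} [Field K] {B : Type*} [Ring B] [Algebra K B]
  {M : Type*} [AddCommGroup M] [Module K M] [Module Bᵐᵒᵖ M] [IsScalarTower K Bᵐᵒᵖ M]

/-- The left action `(b f)(x) = f (x b)` of `B` on the dual of a right `B`-module. -/
noncomputable def dualSMul (b : B) (f : Module.Dual K M) : Module.Dual K M :=
  f ∘ₗ Algebra.lsmul K K M (op b)

theorem dualSMul_apply (b : B) (f : Module.Dual K M) (x : M) :
    dualSMul b f x = f (op b • x) := rfl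

variable (K B M) in
/-- A pairing `D(M) × M → B` that behaves like the evaluation pairing `Hom_B(M, B) × M → B`
under the identification of `D(M)` with `Hom_B(M, B)` over a symmetric algebra `B`. -/
structure DualPairing where
  pair : Module.Dual K M →ₗ[K] M →ₗ[K] B
  pair_smul : ∀ f c x, pair f (op c • x) = pair f x * c
  pair_dualSMul : ∀ c f x, pair (dualSMul c f) x = c * pair f x
  pair_apply : ∀ f (T : Module.End Bᵐᵒᵖ M) x, pair f (T x) = pair (f ∘ₗ T.restrictScalars K) x
  apply_pair_smul : ∀ f g m x, f (op (pair g x) • m) = dualSMul (pair f m) g x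

/-- Over a symmetric algebra `B`, a right `B`-module `M` has a pairing `D(M) × M → B`, and if `M`
is a generator, then `1` is a sum of values of the pairing. -/
theorem exists_dualPairing (hB : IsSymmetricAlgebra K B) (hM : IsGenerator B M) :
    ∃ (P : DualPairing K B M) (n : ℕ) (f : Fin n → Module.Dual K M) (m : Fin n → M),
      ∑ i, P.pair (f i) (m i) = 1 := by
  obtain ⟨-, φ, hφ⟩ := hB
  let E : B ≃ₗ[K] DualBimodule K B := LinearEquiv.ofBijective φ.toLinearMap hφ
  have hleft : ∀ a b x, E (a * b) x = E b (x * a) := fun a b x =>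
    congrArg (fun f : DualBimodule K B => f x) (φ.map_left a b)
  have hright : ∀ a b x, E (b * a) x = E b (a * x) := fun a b x =>
    congrArg (fun f : DualBimodule K B => f x) (φ.map_right a b)
  have hsymm : ∀ a b, E a b = E b a := fun a b => by
    have h₁ := hright a 1 b
    have h₂ := hleft b 1 a
    rw [one_mul] at h₁
    rw [mul_one] at h₂
    rw [h₁, h₂]
  have hext : ∀ a b : B, (∀ x, E a x = E b x) → a = b := fun a b h =>
    E.injective (DualBimodule.ext h)
  let restr : Module.Dual K M → M → DualBimodule K B := fun f x =>
    (f ∘ₗ (Algebra.lsmul K K M).toLinearMap.flip x ∘ₗ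
      (MulOpposite.opLinearEquiv K : B ≃ₗ[K] Bᵐᵒᵖ).toLinearMap : Module.Dual K B)
  have hrestr : ∀ f x b, restr f x b = f (op b • x) := fun _ _ _ => rfl
  -- The element ⟨f, x⟩ of B represents the functional b ↦ f(x b) under B ≅ D(B).
  let pair : Module.Dual K M →ₗ[K] M →ₗ[K] B := LinearMap.mk₂ K (fun f x => E.symm (restr f x))
    (fun f g x => by rw [← map_add]; rfl)
    (fun k f x => by rw [← map_smul]; rfl)
    (fun f x y => by
      rw [← map_add]
      refine congrArg E.symm (DualBimodule.ext fun b => ?_)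
      rw [DualBimodule.add_apply, hrestr, hrestr, hrestr, smul_add, map_add])
    (fun k f x => by
      rw [← map_smul]
      refine congrArg E.symm (DualBimodule.ext fun b => ?_)
      rw [DualBimodule.smul_apply, hrestr, hrestr, smul_comm, map_smul, smul_eq_mul])
  have hpair : ∀ f x b, E (pair f x) b = f (op b • x) := fun f x b => by
    change E (E.symm (restr f x)) b = _
    rw [E.apply_symm_apply, hrestr]
  let P : DualPairing K B M :=
    { pair := pair
      pair_smul := fun f c x => hext _ _ fun b => by
        rw [hpair, hright, hpair, MulOpposite.op_mul, mul_smul]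
      pair_dualSMul := fun c f x => hext _ _ fun b => by
        rw [hpair, hleft, hpair, dualSMul_apply, MulOpposite.op_mul, mul_smul]
      pair_apply := fun f T x => hext _ _ fun b => by
        rw [hpair, hpair, ← T.map_smul]
        rfl
      apply_pair_smul := fun f g m x => by
        rw [dualSMul_apply, ← hpair, ← hpair, hsymm] }
  obtain ⟨n, i, p, hpi⟩ := hM
  -- Composing the components of p with the trace form E(·)(1) gives functionals whose pairings
  -- recover those components; the sum is then p(i(1)) = 1.
  let f : Fin n → Module.Dual K M := fun j =>
    { toFun := fun x => E (p (Pi.single j x)) 1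
      map_add' := fun x y => by
        rw [Pi.single_add, map_add, map_add]
        rfl
      map_smul' := fun k x => by
        have : Pi.single j (k • x) =
            (algebraMap K Bᵐᵒᵖ k) • (Pi.single j x : Fin n → M) := by
          rw [algebraMap_smul, Pi.single_smul]
        rw [this, map_smul, algebraMap_smul, map_smul]
        rfl }
  have key : ∀ j, P.pair (f j) (i 1 j) = p (Pi.single j (i 1 j)) := fun j => hext _ _ fun b => by
    refine (hpair _ _ _).trans ?_
    change E (p (Pi.single j (op b • i 1 j))) 1 = _
    rw [Pi.single_smul, map_smul]
    refine (hright _ _ _).trans ?_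
    rw [mul_one, MulOpposite.unop_op]
  refine ⟨P, n, f, fun j => i 1 j, ?_⟩
  rw [Finset.sum_congr rfl fun j _ => key j, ← map_sum, Finset.univ_sum_single]
  exact LinearMap.congr_fun hpi 1

end GeneratorPairing

/-! ### Matrix coefficients and the comatrix coring. -/

section Coefficients

variable {K : Type*} [Field K] {A : Type*} [Ring A] [Algebra K A] {B : Type*} [Ring B] [Algebra K B]
  {M : Type*} [AddCommGroup M] [Module K M] [Module Bᵐᵒᵖ M] [IsScalarTower K Bᵐᵒᵖ M]
  (σ : A ≃ₐ[K] Module.End Bᵐᵒᵖ M)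

/-- The matrix coefficients `a ↦ f (a m)` of `M` as functionals on `A ≅ End_B(M)`. -/
noncomputable def coeff : M →ₗ[K] Module.Dual K M →ₗ[K] DualBimodule K A :=
  LinearMap.mk₂ K
    (fun m f => (
      { toFun := fun a => f (σ a m)
        map_add' := fun a b => by rw [map_add, LinearMap.add_apply, map_add]
        map_smul' := fun k a => by rw [map_smul, LinearMap.smul_apply, map_smul]; rfl } :
          Module.Dual K A))
    (fun m n f => DualBimodule.ext fun a =>
      (congrArg f (map_add (σ a) m n)).trans (map_add f _ _))
    (fun k m f => DualBimodule.ext fun a =>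
      (congrArg f (((σ a).restrictScalars K).map_smul k m)).trans (map_smul f _ _))
    (fun _ _ _ => rfl)
    (fun _ _ _ => rfl)

theorem coeff_apply (m : M) (f : Module.Dual K M) (a : A) : coeff σ m f a = f (σ a m) := rfl

theorem coeff_smul (b : B) (m : M) (f : Module.Dual K M) :
    coeff σ (op b • m) f = coeff σ m (dualSMul b f) :=
  DualBimodule.ext fun a => congrArg f ((σ a).map_smul (op b) m)

theorem left_smul_coeff (a : A) (m : M) (f : Module.Dual K M) :
    a • coeff σ m f = coeff σ (σ a m) f :=
  DualBimodule.ext fun x => by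
    rw [DualBimodule.left_smul_apply, coeff_apply, coeff_apply, map_mul, Module.End.mul_apply]

theorem right_smul_coeff (a : A) (m : M) (f : Module.Dual K M) :
    op a • coeff σ m f = coeff σ m (f ∘ₗ (σ a).restrictScalars K) :=
  DualBimodule.ext fun x => by
    rw [DualBimodule.right_smul_apply, coeff_apply, coeff_apply, map_mul, Module.End.mul_apply]
    rfl

variable [Module.Finite K M]

/-- A balanced bilinear form on `M × D(M)` is given by evaluating the matrix coefficients. -/
theorem exists_eq_coeff_apply (h : M →ₗ[K] Module.Dual K M →ₗ[K] K)
    (hh : ∀ (b : B) m f, h (op b • m) f = h m (dualSMul b f)) :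
    ∃ a : A, ∀ m f, h m f = coeff σ m f a := by
  -- By biduality the form h is a map M → D(D(M)) ≅ M, and balancedness makes it B-linear.
  let T : M →ₗ[K] M := (Module.evalEquiv K M).symm.toLinearMap ∘ₗ h
  have hT : ∀ m f, f (T m) = h m f := fun m f => Module.apply_evalEquiv_symm_apply K M f (h m)
  let T' : Module.End Bᵐᵒᵖ M :=
    { toFun := T
      map_add' := T.map_add
      map_smul' := fun b m => by
        refine sub_eq_zero.1 ((Module.forall_dual_apply_eq_zero_iff K _).1 fun f => ?_)
        rw [map_sub, sub_eq_zero, hT]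
        have := hh b.unop m f
        rw [MulOpposite.op_unop] at this
        rw [this, ← hT, dualSMul_apply, MulOpposite.op_unop, RingHom.id_apply] }
  refine ⟨σ.symm T', fun m f => ?_⟩
  rw [coeff_apply, AlgEquiv.apply_symm_apply, ← hT]
  rfl

/-- The matrix coefficients identify `D(A)` with `M ⊗_B D(M)`: balanced bilinear maps factor. -/
theorem exists_lift_coeff {X : Type*} [AddCommGroup X] [Module K X]
    (q : M →ₗ[K] Module.Dual K M →ₗ[K] X)
    (hq : ∀ (b : B) m f, q (op b • m) f = q m (dualSMul b f)) :
    ∃ r : DualBimodule K A →ₗ[K] X, ∀ m f, r (coeff σ m f) = q m f := by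
  obtain ⟨r, hr⟩ := exists_comp_eq_of_ker_le_ker (V := M ⊗[K] Module.Dual K M)
    (TensorProduct.lift (coeff σ)) (TensorProduct.lift q) fun x hx => by
      refine (Module.forall_dual_apply_eq_zero_iff K _).1 fun h => ?_
      -- Each functional of q is evaluation of coefficients at some a ∈ A, so q vanishes wherever
      -- the coefficients do.
      obtain ⟨a, ha⟩ := exists_eq_coeff_apply σ (q.compr₂ h) fun b m f => by
        rw [LinearMap.compr₂_apply, LinearMap.compr₂_apply, hq]
      have key : ∀ y, h (TensorProduct.lift q y) = TensorProduct.lift (coeff σ) y a := fun y => by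
        induction y using TensorProduct.induction_on with
        | zero => rw [map_zero, map_zero, map_zero]; rfl
        | tmul m f => exact ha m f
        | add y z hy hz => rw [map_add, map_add, map_add, DualBimodule.add_apply, hy, hz]
      rw [key, hx]
      rfl
  exact ⟨r, fun m f => hr (m ⊗ₜ f)⟩

@[elab_as_elim]
theorem coeff_induction [Module.Finite K A] {P : DualBimodule K A → Prop} (w : DualBimodule K A)
    (coeff : ∀ m f, P (coeff σ m f)) (add : ∀ v w, P v → P w → P (v + w)) : P w := by
  have hsurj : Function.Surjective (TensorProduct.lift (BocsTheory.coeff σ)) := by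
    rw [← LinearMap.range_eq_top]
    by_contra hne
    obtain ⟨h, h0, hle⟩ := Submodule.exists_le_ker_of_lt_top _ (lt_top_iff_ne_top.2 hne)
    obtain ⟨a, ha⟩ := DualBimodule.exists_eval h
    have hz : ∀ (m : M) (f : Module.Dual K M), f (σ a m) = 0 := fun m f => by
      have : h (BocsTheory.coeff σ m f) = 0 := hle ⟨m ⊗ₜ f, rfl⟩
      rwa [ha] at this
    have ha0 : a = 0 := by
      rw [← map_eq_zero_iff σ σ.injective]
      exact LinearMap.ext fun m => (Module.forall_dual_apply_eq_zero_iff K _).1 (hz m)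
    exact h0 (LinearMap.ext fun f => by rw [ha, ha0, DualBimodule.map_zero]; rfl)
  obtain ⟨y, rfl⟩ := hsurj w
  induction y using TensorProduct.induction_on with
  | zero =>
    have := coeff 0 0
    rw [map_zero] at this
    rwa [map_zero]
  | tmul m f => exact coeff m f
  | add y z hy hz => rw [map_add]; exact add _ _ hy hz

/-- The comatrix coring structure on `D(A)` for `A ≅ End_B(M)`. -/
theorem nonempty_bocs_of_pairing [Module.Finite K A] (P : DualPairing K B M) {n : ℕ}
    (f : Fin n → Module.Dual K M) (u : Fin n → M) (hfu : ∑ i, P.pair (f i) (u i) = 1)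
    (σ : A ≃ₐ[K] Module.End Bᵐᵒᵖ M) : Nonempty (Bocs K A (DualBimodule K A)) := by
  let R : M →ₗ[K] Module.Dual K M →ₗ[K] A := LinearMap.mk₂ K
    (fun m g => σ.symm
      { toFun := fun x => op (P.pair g x) • m
        map_add' := fun x y => by rw [map_add, MulOpposite.op_add, add_smul]
        map_smul' := fun b x => by
          have := P.pair_smul g b.unop x
          rw [MulOpposite.op_unop] at this
          rw [this, MulOpposite.op_mul, MulOpposite.op_unop, mul_smul, RingHom.id_apply] })
    (fun m m' g => by
      rw [← map_add]; exact congrArg σ.symm (LinearMap.ext fun x => smul_add _ m m'))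
    (fun k m g => by
      rw [← map_smul]; exact congrArg σ.symm (LinearMap.ext fun x => smul_comm _ k m))
    (fun m g g' => by
      rw [← map_add]
      refine congrArg σ.symm (LinearMap.ext fun x => ?_)
      change op (P.pair (g + g') x) • m = op (P.pair g x) • m + op (P.pair g' x) • m
      rw [map_add, LinearMap.add_apply, MulOpposite.op_add, add_smul])
    (fun k m g => by
      rw [← map_smul]
      refine congrArg σ.symm (LinearMap.ext fun x => ?_)
      change op (P.pair (k • g) x) • m = k • op (P.pair g x) • m
      rw [map_smul, LinearMap.smul_apply, MulOpposite.op_smul, smul_assoc])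
  have hR : ∀ m g x, σ (R m g) x = op (P.pair g x) • m := fun m g x => by
    change σ (σ.symm _) x = _
    rw [AlgEquiv.apply_symm_apply]
    rfl
  have hextA : ∀ a b : A, (∀ x, σ a x = σ b x) → a = b := fun a b h =>
    σ.injective (LinearMap.ext h)
  obtain ⟨ε, hε⟩ := exists_lift_coeff σ R fun b m g => hextA _ _ fun x => by
    rw [hR, hR, P.pair_dualSMul, MulOpposite.op_mul, mul_smul]
  have hεl : ∀ (a : A) w, ε (a • w) = a • ε w := fun a w => by
    induction w using coeff_induction σ with
    | coeff m g =>
      rw [left_smul_coeff, hε, hε]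
      refine hextA _ _ fun x => ?_
      rw [hR, smul_eq_mul, map_mul, Module.End.mul_apply, hR, map_smul]
    | add v w hv hw => rw [smul_add, map_add, map_add, hv, hw, smul_add]
  have hεr : ∀ (a : A) w, ε (op a • w) = op a • ε w := fun a w => by
    induction w using coeff_induction σ with
    | coeff m g =>
      rw [right_smul_coeff, hε, hε]
      refine hextA _ _ fun x => ?_
      rw [hR, op_smul_eq_mul, map_mul, Module.End.mul_apply, hR, P.pair_apply]
    | add v w hv hw => rw [smul_add, map_add, map_add, hv, hw, smul_add]
  -- Symmetry of the pairing gives Σ f_i(u_i⟨g, x⟩) = Σ g(x⟨f_i, u_i⟩) = g(x).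
  have hsumr : ∀ m g, ∑ i, op (R (u i) g) • coeff σ m (f i) = coeff σ m g := fun m g => by
    simp only [right_smul_coeff]
    rw [← map_sum]
    congr 1
    refine LinearMap.ext fun x => ?_
    rw [LinearMap.sum_apply]
    have : ∀ i, (f i ∘ₗ (σ (R (u i) g)).restrictScalars K) x =
        g (op (P.pair (f i) (u i)) • x) := fun i => by
      rw [← dualSMul_apply, ← P.apply_pair_smul, ← hR]
      rfl
    rw [Finset.sum_congr rfl fun i _ => this i, ← map_sum, ← Finset.sum_smul,
      ← Finset.op_sum, hfu, MulOpposite.op_one, one_smul]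
  have hsuml : ∀ (b : B) m g, ∑ i, R m (dualSMul b (f i)) • coeff σ (u i) g =
      coeff σ (op b • m) g := fun b m g => by
    simp only [left_smul_coeff, hR, P.pair_dualSMul]
    rw [← LinearMap.sum_apply, ← map_sum, ← Finset.sum_smul, ← Finset.op_sum,
      ← Finset.mul_sum, hfu, mul_one]
  have hone : ∀ g : Module.Dual K M, dualSMul (1 : B) g = g := fun g => LinearMap.ext fun x => by
    rw [dualSMul_apply, MulOpposite.op_one, one_smul]
  let q : M →ₗ[K] Module.Dual K M →ₗ[K] BTensor K A (DualBimodule K A) (DualBimodule K A) :=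
    ∑ i, ((TensorProduct.mk K (DualBimodule K A) (DualBimodule K A)).compl₁₂
      ((coeff σ).flip (f i)) (coeff σ (u i))).compr₂ (BTensor.proj K A _ _)
  have hq : ∀ m g, q m g = ∑ i, BTensor.tmul K A (coeff σ m (f i)) (coeff σ (u i) g) :=
    fun m g => by
      simp only [q, LinearMap.sum_apply]
      rfl
  obtain ⟨μ, hμ⟩ := exists_lift_coeff σ q fun b m g => by
    rw [hq, hq]
    -- To move b across, expand the left factor by `hsumr`, slide the elements of A over the tensor
    -- sign, and collapse the right factor by `hsuml`.
    calc ∑ i, BTensor.tmul K A (coeff σ (op b • m) (f i)) (coeff σ (u i) g)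
      _ = ∑ i, ∑ j, BTensor.tmul K A (coeff σ m (f j))
            (R (u j) (dualSMul b (f i)) • coeff σ (u i) g) := by
          refine Finset.sum_congr rfl fun i _ => ?_
          rw [coeff_smul, ← hsumr m (dualSMul b (f i)), BTensor.sum_tmul]
          simp only [BTensor.tmul_balance]
      _ = _ := by
          rw [Finset.sum_comm]
          refine Finset.sum_congr rfl fun j _ => ?_
          rw [← BTensor.tmul_sum, hsuml, coeff_smul]
  have hμ' : ∀ m g, μ (coeff σ m g) =
      ∑ i, BTensor.tmul K A (coeff σ m (f i)) (coeff σ (u i) g) := fun m g => by rw [hμ, hq]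
  have hμl : ∀ (a : A) w, μ (a • w) = a • μ w := fun a w => by
    induction w using coeff_induction σ with
    | coeff m g =>
      rw [left_smul_coeff, hμ', hμ', Finset.smul_sum]
      simp only [BTensor.left_smul_tmul, left_smul_coeff]
    | add v w hv hw => rw [smul_add, map_add, map_add, hv, hw, smul_add]
  have hμr : ∀ (a : A) w, μ (op a • w) = op a • μ w := fun a w => by
    induction w using coeff_induction σ with
    | coeff m g =>
      rw [right_smul_coeff, hμ', hμ', Finset.smul_sum]
      simp only [BTensor.right_smul_tmul, right_smul_coeff]
    | add v w hv hw => rw [smul_add, map_add, map_add, hv, hw, smul_add]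
  refine ⟨⟨⟨μ, hμl, hμr⟩, ⟨ε, hεl, hεr⟩, fun w => ?_, fun w => ?_, fun w => ?_⟩⟩
  · induction w using coeff_induction σ with
    | coeff m g =>
      change BTensor.map _ ε _ _ (μ _) = _
      rw [hμ', map_sum, ← hsumr m g, BTensor.sum_tmul]
      refine Finset.sum_congr rfl fun i _ => ?_
      rw [BTensor.map_tmul, BTensor.tmul_balance, hε, smul_eq_mul, mul_one]
      rfl
    | add v w hv hw => rw [map_add, map_add, hv, hw, BTensor.add_tmul]
  · induction w using coeff_induction σ with
    | coeff m g =>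
      change BTensor.map ε _ _ _ (μ _) = _
      have h := hsuml 1 m g
      rw [MulOpposite.op_one, one_smul] at h
      rw [hμ', map_sum, ← h, BTensor.tmul_sum]
      refine Finset.sum_congr rfl fun i _ => ?_
      rw [BTensor.map_tmul, ← BTensor.tmul_balance, hε, hone, op_smul_eq_mul, one_mul]
      rfl
    | add v w hv hw => rw [map_add, map_add, hv, hw, BTensor.tmul_add]
  · induction w using coeff_induction σ with
    | coeff m g =>
      change BTensor.assoc K A _ _ _ (BTensor.map μ _ _ _ (μ _)) = BTensor.map _ μ _ _ (μ _)
      rw [hμ', map_sum, map_sum, map_sum]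
      simp only [BTensor.map_tmul, hμ', LinearMap.id_apply, BTensor.sum_tmul, BTensor.tmul_sum,
        map_sum, BTensor.assoc_tmul]
      -- Both sides are the double sum of (m ⊗ f_i) ⊗ (u_i ⊗ f_j) ⊗ (u_j ⊗ g), summed in opposite
      -- orders.
      exact Finset.sum_comm
    | add v w hv hw => simp only [map_add, hv, hw]

end Coefficients

theorem IsGendoSymmetric.nonempty_bocs {K : Type*} [Field K] {A : Type*} [Ring A] [Algebra K A]
    [Module.Finite K A] (h : IsGendoSymmetric K A) :
    Nonempty (Bocs K A (DualBimodule K A)) := by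
  obtain ⟨B, _, _, M, _, _, _, _, hB, _, hM, ⟨σ⟩⟩ := h
  obtain ⟨P, n, f, u, hfu⟩ := exists_dualPairing (K := K) hB hM
  exact nonempty_bocs_of_pairing P f u hfu σ

end BocsTheory

theorem theorem2p1 (K : Type*) [Field K] (A : Type*) [Ring A] [Algebra K A]
    [Module.Finite K A] :
    (BocsTheory.IsGendoSymmetric K A ↔
      Nonempty (BocsTheory.Bocs K A (BocsTheory.DualBimodule K A))) ∧
    ∀ S : BocsTheory.Bocs K A (BocsTheory.DualBimodule K A),
      Function.Bijective S.comul.toLinearMap :=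
  ⟨⟨fun h => h.nonempty_bocs, fun ⟨S⟩ => S.isGendoSymmetric⟩, fun S => S.comul_bijective⟩
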